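/- Let $E$ be a (real) Banach lattice with order continuous norm (every downward directed set in $E$ with infimum $0$ converges to $0$ in norm), let $Y$ be a (real) Banach space, and let $T:E\to Y$ be a bounded linear operator. For a closed subspace $M$ of $E$, let $T_M$ denote the restriction of $T$ to $M$ and let $\mathrm{ds}(M)$ be the set of all sequences $(x_n)_{n\in\mathbb N}$ of non-zero vectors of $M$ that are pairwise disjoint in $E$ (i.e. $|x_m|\wedge|x_n|=0$ for $m\ne n$); let $[x_n]$ denote the closed linear span of $(x_n)$. The operator $T$ is called disjointly non-singular if there is no $(x_n)\in \mathrm{ds}(E)$ such that $T_{[x_n]}$ is strictly singular, where a bounded operator is strictly singular if its restriction to any closed infinite dimensional subspace of its domain is not an isomorphism onto its image. Let $j(S)=\inf_{\|x\|=1}\|Sx\|$ be the injection modulus of a bounded operator $S$, and put $$\sigma_d(T)=\inf_{(x_n)\in \mathrm{ds}(E)}\ \sup_{(y_n)\in \mathrm{ds}([x_n])} j\big(T_{[y_n]}\big)\in[0,\infty],$$ with the convention $\inf\emptyset=+\infty$ (relevant only if $E$ is finite dimensional). Then $T$ is disjointly non-singular if and only if $\sigma_d(T)>0$. -/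

import Mathlib

open scoped ENNReal

noncomputable section

namespace BanachLatticeDNS

/-- The norm of a Banach lattice is order continuous: every nonempty downward directed set
with infimum `0`, regarded as a decreasing net indexed by itself, converges to `0` in norm. -/
def IsOrderContinuous (E : Type*) [NormedAddCommGroup E] [Lattice E] : Prop :=
  ∀ s : Set E, s.Nonempty → DirectedOn (fun a b => b ≤ a) s → IsGLB s 0 →
    ∀ ε : ℝ, 0 < ε → ∃ x ∈ s, ∀ y ∈ s, y ≤ x → ‖y‖ < ε

section Operators

variable {X Y : Type*} [NormedAddCommGroup X] [NormedSpace ℝ X]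
  [NormedAddCommGroup Y] [NormedSpace ℝ Y]

/-- The restriction `T_M` of an operator `T` to a subspace `M`. -/
def restr (T : X →L[ℝ] Y) (M : Submodule ℝ X) : M →L[ℝ] Y :=
  T.comp M.subtypeL

/-- `T` is strictly singular: there is no closed infinite dimensional subspace `M` such that
`T_M` is an isomorphism onto its image (that is, a homeomorphism onto its image). -/
def IsStrictlySingular (T : X →L[ℝ] Y) : Prop :=
  ¬ ∃ M : Submodule ℝ X, IsClosed (M : Set X) ∧ ¬ FiniteDimensional ℝ M ∧
    Topology.IsEmbedding (restr T M)

/-- The injection modulus `j(T) = inf {‖T x‖ : ‖x‖ = 1}`, with values in `[0, ∞]`. -/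
def injModulus (T : X →L[ℝ] Y) : ℝ≥0∞ :=
  ⨅ (x : X) (_ : ‖x‖ = 1), ‖T x‖ₑ

/-- The closed subspace `[x_n]` generated by a sequence. -/
def closedSpan (x : ℕ → X) : Submodule ℝ X :=
  (Submodule.span ℝ (Set.range x)).topologicalClosure

end Operators

section Lattice

variable {E Y : Type*} [NormedAddCommGroup E] [Lattice E] [NormedSpace ℝ E]
  [NormedAddCommGroup Y] [NormedSpace ℝ Y]

/-- The sequences of non-zero, pairwise disjoint vectors of the Banach lattice `E` all of whose
terms lie in the subspace `M`. Disjointness of `a` and `b` means `|a| ⊓ |b| = 0`. -/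
def disjSeqs (M : Submodule ℝ E) : Set (ℕ → E) :=
  {x | (∀ n, x n ∈ M) ∧ (∀ n, x n ≠ 0) ∧ ∀ m n, m ≠ n → |x m| ⊓ |x n| = 0}

/-- `T` is disjointly non-singular: there is no disjoint sequence of non-zero vectors `x` in `E`
such that the restriction of `T` to `[x_n]` is strictly singular. -/
def IsDisjointlyNonSingular (T : E →L[ℝ] Y) : Prop :=
  ¬ ∃ x ∈ disjSeqs (⊤ : Submodule ℝ E), IsStrictlySingular (restr T (closedSpan x))

/-- `σ_d(T) = inf_{x ∈ ds(E)} sup_{y ∈ ds([x_n])} j(T_{[y_n]})`, with values in `[0, ∞]`; as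
usual the infimum over the empty family, which occurs when `E` has no disjoint sequence of
non-zero vectors, is `∞`. -/
def sigmaD (T : E →L[ℝ] Y) : ℝ≥0∞ :=
  ⨅ x ∈ disjSeqs (⊤ : Submodule ℝ E), ⨆ y ∈ disjSeqs (closedSpan x),
    injModulus (restr T (closedSpan y))

end Lattice

end BanachLatticeDNS

end

set_option linter.unusedSectionVars false

namespace BanachLatticeDNS

section Disjoint

variable {E : Type*} [NormedAddCommGroup E] [Lattice E] [IsOrderedAddMonoid E] [HasSolidNorm E]
  [NormedSpace ℝ E] [IsOrderedModule ℝ E]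

/-! If `σ_d(T) > 0`, every `[x_n]` contains some `[y_n]` on which `T` is bounded below, so `T` is
not strictly singular on `[x_n]`. Conversely, let `σ_d(T) = 0`. For each `ε` some disjoint sequence
has `j(T) < ε` on all its tails, and order continuity makes far tails almost disjoint from any given
`u ≥ 0`. This gives normalized `w` with `‖T w‖` and `‖|w| ⊓ u‖` small
(`exists_almost_disjoint_of_sigmaD_eq_zero`). Choosing `w_n` inductively against large multiples of
its predecessors and truncating (`excess_disjoint`) gives an exactly disjoint `x_n` with `‖T x_n‖ ≤
C 2⁻ⁿ ‖x_n‖`. Then `T` has norm at most `2C 2⁻ᴺ` on the `N`-th tail, and every infinite dimensional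
subspace of `[x_n]` meets every tail, so `T` is strictly singular there. -/

theorem inf_add_le_of_nonneg {a b c : E} (ha : 0 ≤ a) (hb : 0 ≤ b) (hc : 0 ≤ c) :
    a ⊓ (b + c) ≤ a ⊓ b + a ⊓ c := by
  rw [add_inf, inf_add, inf_add]
  refine le_inf (le_inf ?_ ?_) (le_inf ?_ ?_)
  · exact inf_le_left.trans (le_add_of_nonneg_left ha)
  · exact inf_le_left.trans (le_add_of_nonneg_left hb)
  · exact inf_le_left.trans (le_add_of_nonneg_right hc)
  · exact inf_le_right

theorem abs_smul_of_nonneg_le {r : ℝ} (hr : 0 ≤ r) (b : E) : |r • b| ≤ r • |b| := by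
  refine abs_le'.2 ⟨smul_le_smul_of_nonneg_left (le_abs_self b) hr, ?_⟩
  rw [← smul_neg]
  exact smul_le_smul_of_nonneg_left (neg_le_abs b) hr

theorem abs_smul_le_abs_smul (r : ℝ) (b : E) : |r • b| ≤ |r| • |b| := by
  rcases le_total 0 r with hr | hr
  · rw [abs_of_nonneg hr]
    exact abs_smul_of_nonneg_le hr b
  · rw [abs_of_nonpos hr, ← abs_neg, ← neg_smul]
    exact abs_smul_of_nonneg_le (neg_nonneg.2 hr) b

/-- The disjoint complement of an element. -/
def disjointCompl (a : E) : Submodule ℝ E where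
  carrier := {b | |a| ⊓ |b| = 0}
  zero_mem' := by simp
  add_mem' := by
    intro b c hb hc
    refine le_antisymm ?_ (le_inf (abs_nonneg _) (abs_nonneg _))
    calc |a| ⊓ |b + c| ≤ |a| ⊓ (|b| + |c|) := inf_le_inf_left _ (abs_add_le b c)
      _ ≤ |a| ⊓ |b| + |a| ⊓ |c| :=
        inf_add_le_of_nonneg (abs_nonneg _) (abs_nonneg _) (abs_nonneg _)
      _ = 0 := by rw [show |a| ⊓ |b| = 0 from hb, show |a| ⊓ |c| = 0 from hc, add_zero]
  smul_mem' := by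
    intro r b hb
    have hr : (0 : ℝ) ≤ 1 + |r| := by positivity
    have hr' : 0 < 1 + |r| := by positivity
    refine le_antisymm ?_ (le_inf (abs_nonneg _) (abs_nonneg _))
    have h1 : (1 + |r|)⁻¹ • (|a| ⊓ |r • b|) ≤ |a| ⊓ |b| := by
      refine le_inf ?_ ?_
      · rw [inv_smul_le_iff_of_pos hr']
        refine inf_le_left.trans ?_
        rw [add_smul, one_smul]
        exact le_add_of_nonneg_right (smul_nonneg (abs_nonneg _) (abs_nonneg _))
      · rw [inv_smul_le_iff_of_pos hr']
        refine inf_le_right.trans ((abs_smul_le_abs_smul r b).trans ?_)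
        rw [add_smul, one_smul]
        exact le_add_of_nonneg_left (abs_nonneg _)
    rw [show |a| ⊓ |b| = 0 from hb, inv_smul_le_iff_of_pos hr', smul_zero] at h1
    exact h1

theorem mem_disjointCompl {a b : E} : b ∈ disjointCompl a ↔ |a| ⊓ |b| = 0 := Iff.rfl

theorem abs_inf_abs_eq_zero_of_le {a b c d : E} (h : a ⊓ b = 0) (hc : |c| ≤ a) (hd : |d| ≤ b) :
    |c| ⊓ |d| = 0 :=
  le_antisymm ((inf_le_inf hc hd).trans h.le) (le_inf (abs_nonneg _) (abs_nonneg _))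

theorem abs_le_abs_add_of_disjoint {a b : E} (h : |a| ⊓ |b| = 0) : |a| ≤ |a + b| := by
  have h1 : |a| ≤ |a + b| + |b| := by
    have := abs_add_le (a + b) (-b)
    rwa [add_neg_cancel_right, abs_neg] at this
  calc |a| ≤ |a| ⊓ (|a + b| + |b|) := le_inf le_rfl h1
    _ ≤ |a| ⊓ |a + b| + |a| ⊓ |b| :=
      inf_add_le_of_nonneg (abs_nonneg _) (abs_nonneg _) (abs_nonneg _)
    _ ≤ |a + b| := by rw [h, add_zero]; exact inf_le_right

theorem norm_le_norm_add_of_disjoint {a b : E} (h : |a| ⊓ |b| = 0) : ‖a‖ ≤ ‖a + b‖ :=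
  HasSolidNorm.solid (abs_le_abs_add_of_disjoint h)

theorem add_inf_ge_of_disjoint {a b u : E} (ha : 0 ≤ a) (hb : 0 ≤ b) (hu : 0 ≤ u)
    (h : a ⊓ b = 0) : a ⊓ u + b ⊓ u ≤ (a + b) ⊓ u := by
  have h0 : (a ⊓ u) ⊓ (b ⊓ u) = 0 :=
    le_antisymm ((inf_le_inf inf_le_left inf_le_left).trans h.le)
      (le_inf (le_inf ha hu) (le_inf hb hu))
  have h1 := inf_add_sup (a ⊓ u) (b ⊓ u)
  rw [h0, zero_add] at h1
  rw [← h1]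
  refine sup_le (inf_le_inf_right _ (le_add_of_nonneg_right hb))
    (inf_le_inf_right _ (le_add_of_nonneg_left ha))

/-- The solid norm forces the Archimedean property: `k‖z‖ ≤ ‖b‖` for all `k`. -/
theorem eq_zero_of_nsmul_le {z b : E} (hz : 0 ≤ z) (h : ∀ k : ℕ, k • z ≤ b) : z = 0 := by
  by_contra hne
  have hpos : 0 < ‖z‖ := norm_pos_iff.2 hne
  obtain ⟨k, hk⟩ := exists_nat_gt (‖b‖ / ‖z‖)
  have h1 : ‖k • z‖ ≤ ‖b‖ := by
    refine HasSolidNorm.solid ?_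
    rw [abs_of_nonneg (nsmul_nonneg hz k)]
    exact (h k).trans (le_abs_self b)
  rw [div_lt_iff₀ hpos] at hk
  rw [← Nat.cast_smul_eq_nsmul ℝ, norm_smul, Real.norm_natCast] at h1
  exact absurd h1 (not_le.2 hk)

/-! ### Order continuity and tails of disjoint sequences -/

/-- In a Banach lattice with order continuous norm, increasing order bounded sequences are
Cauchy in norm. -/
theorem IsOrderContinuous.exists_norm_sub_lt (hE : IsOrderContinuous E) {p : ℕ → E}
    (hp : Monotone p) {u : E} (hu : ∀ n, p n ≤ u) {ε : ℝ} (hε : 0 < ε) :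
    ∃ N, ∀ m, N ≤ m → ‖p m - p N‖ < ε := by
  -- Since `p` may have no supremum, all differences (upper bound of `p`) minus (term of `p`) are
  -- used. A lower bound `z` of them lets every upper bound be lowered by `z ⊔ 0` again and again,
  -- so `z ⊔ 0 = 0` by the Archimedean property.
  obtain ⟨x, ⟨b, n, hb, rfl⟩, hx⟩ := hE {d | ∃ b n, (∀ m, p m ≤ b) ∧ d = b - p n}
    ⟨u - p 0, u, 0, hu, rfl⟩ (by
      rintro _ ⟨b, n, hb, rfl⟩ _ ⟨b', n', hb', rfl⟩
      refine ⟨b ⊓ b' - p (max n n'), ⟨_, _, fun m => le_inf (hb m) (hb' m), rfl⟩, ?_, ?_⟩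
      · exact sub_le_sub inf_le_left (hp (le_max_left _ _))
      · exact sub_le_sub inf_le_right (hp (le_max_right _ _)))
    (by
      refine ⟨?_, ?_⟩
      · rintro _ ⟨b, n, hb, rfl⟩
        exact sub_nonneg.2 (hb n)
      · intro z hz
        have hz' : ∀ b, (∀ m, p m ≤ b) → ∀ m, p m ≤ b - z ⊔ 0 := by
          intro b hb m
          rw [le_sub_comm]
          exact sup_le (hz ⟨b, m, hb, rfl⟩) (sub_nonneg.2 (hb m))
        have hk : ∀ k : ℕ, ∀ m, p m ≤ u - k • (z ⊔ 0) := by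
          intro k
          induction k with
          | zero => simpa using hu
          | succ k ih =>
            intro m
            rw [succ_nsmul, ← sub_sub]
            exact hz' _ ih m
        have h0 : z ⊔ 0 = 0 := eq_zero_of_nsmul_le (b := u - p 0) le_sup_right
          fun k => le_sub_comm.1 (hk k 0)
        exact le_sup_left.trans h0.le) ε hε
  refine ⟨n, fun m hm => ?_⟩
  have h0 : 0 ≤ p m - p n := sub_nonneg.2 (hp hm)
  have h1 : p m - p n ≤ b - p n := sub_le_sub_right (hb m) _
  refine (HasSolidNorm.solid ?_).trans_lt (hx _ ⟨b, n, hb, rfl⟩ le_rfl)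
  rw [abs_of_nonneg h0, abs_of_nonneg (h0.trans h1)]
  exact h1

/-- One index `K` serves as both multiplier and length, so that all of the span is dominated by a
single increasing sequence. -/
theorem exists_abs_le_of_mem_span {x : ℕ → E} {v : E} (hv : v ∈ Submodule.span ℝ (Set.range x)) :
    ∃ K : ℕ, |v| ≤ K • ∑ i ∈ Finset.range K, |x i| := by
  have mono : ∀ {K L : ℕ}, K ≤ L →
      K • ∑ i ∈ Finset.range K, |x i| ≤ L • ∑ i ∈ Finset.range L, |x i| := by
    intro K L h
    have h1 : ∑ i ∈ Finset.range K, |x i| ≤ ∑ i ∈ Finset.range L, |x i| :=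
      Finset.sum_le_sum_of_subset_of_nonneg (Finset.range_mono h) fun i _ _ => abs_nonneg _
    exact (nsmul_le_nsmul_right h1 K).trans
      (nsmul_le_nsmul_left (Finset.sum_nonneg fun i _ => abs_nonneg _) h)
  induction hv using Submodule.span_induction with
  | mem v hv =>
    obtain ⟨n, rfl⟩ := hv
    refine ⟨n + 1, ?_⟩
    have h1 : |x n| ≤ ∑ i ∈ Finset.range (n + 1), |x i| :=
      Finset.single_le_sum (f := fun i => |x i|) (fun i _ => abs_nonneg _) (by simp)
    refine h1.trans ?_
    rw [succ_nsmul]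
    exact le_add_of_nonneg_left
      (nsmul_nonneg (Finset.sum_nonneg fun i _ => abs_nonneg _) _)
  | zero => exact ⟨0, by simp⟩
  | add v w _ _ hv hw =>
    obtain ⟨K, hK⟩ := hv
    obtain ⟨L, hL⟩ := hw
    refine ⟨K + L, (abs_add_le v w).trans ((add_le_add hK hL).trans ?_)⟩
    rw [add_nsmul]
    refine add_le_add (nsmul_le_nsmul_right ?_ K) (nsmul_le_nsmul_right ?_ L) <;>
    exact Finset.sum_le_sum_of_subset_of_nonneg (Finset.range_mono (by omega))
        fun i _ _ => abs_nonneg _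
  | smul r v _ hv =>
    obtain ⟨K, hK⟩ := hv
    obtain ⟨k, hk⟩ := exists_nat_ge |r|
    refine ⟨(k + 1) * K, (abs_smul_le_abs_smul r v).trans ?_⟩
    have h1 : |r| • |v| ≤ k • |v| := by
      rw [← Nat.cast_smul_eq_nsmul ℝ]
      exact smul_le_smul_of_nonneg_right hk (abs_nonneg _)
    refine h1.trans ((nsmul_le_nsmul_right hK k).trans ?_)
    rw [← mul_nsmul']
    have h2 : ∑ i ∈ Finset.range K, |x i| ≤ ∑ i ∈ Finset.range ((k + 1) * K), |x i| :=
      Finset.sum_le_sum_of_subset_of_nonneg (Finset.range_mono (by nlinarith))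
        fun i _ _ => abs_nonneg _
    exact (nsmul_le_nsmul_right h2 _).trans
      (nsmul_le_nsmul_left (Finset.sum_nonneg fun i _ => abs_nonneg _) (by nlinarith))

/-- The tails of a disjoint sequence become almost disjoint from any given positive element. -/
theorem IsOrderContinuous.exists_tail_norm_inf_lt (hE : IsOrderContinuous E) {x : ℕ → E}
    (hx : ∀ m n, m ≠ n → |x m| ⊓ |x n| = 0) {u : E} (hu : 0 ≤ u) {ε : ℝ} (hε : 0 < ε) :
    ∃ N : ℕ, ∀ v ∈ Submodule.span ℝ (Set.range fun n => x (N + n)), ‖|v| ⊓ u‖ < ε := by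
  have hs : ∀ n, 0 ≤ ∑ i ∈ Finset.range n, |x i| :=
    fun n => Finset.sum_nonneg fun i _ => abs_nonneg _
  have hsm : ∀ {K L : ℕ}, K ≤ L →
      ∑ i ∈ Finset.range K, |x i| ≤ ∑ i ∈ Finset.range L, |x i| := fun h =>
    Finset.sum_le_sum_of_subset_of_nonneg (Finset.range_mono h) fun i _ _ => abs_nonneg _
  obtain ⟨N, hN⟩ := hE.exists_norm_sub_lt
    (p := fun n => (n • ∑ i ∈ Finset.range n, |x i|) ⊓ u)
    (fun K L h => inf_le_inf_right _ ((nsmul_le_nsmul_right (hsm h) K).trans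
      (nsmul_le_nsmul_left (hs _) h))) (fun n => inf_le_right) hε
  refine ⟨N, fun v hv => ?_⟩
  obtain ⟨K, hK⟩ := exists_abs_le_of_mem_span hv
  set a := N • ∑ i ∈ Finset.range N, |x i| with ha_def
  have ha : 0 ≤ a := nsmul_nonneg (hs _) _
  have hadj : a ⊓ |v| = 0 := by
    have hmem : ∀ i < N, x i ∈ disjointCompl v := by
      intro i hi
      rw [mem_disjointCompl, inf_comm, ← mem_disjointCompl]
      refine (Submodule.span_le.2 ?_ : _ ≤ disjointCompl (x i)) hv
      rintro _ ⟨n, rfl⟩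
      exact hx _ _ (by omega)
    have : a ∈ disjointCompl v := by
      refine nsmul_mem (Submodule.sum_mem _ fun i hi => ?_) N
      rw [mem_disjointCompl, abs_abs]
      exact hmem i (Finset.mem_range.1 hi)
    rwa [mem_disjointCompl, abs_of_nonneg ha, inf_comm] at this
  have h1 : a + |v| ≤ (N + K) • ∑ i ∈ Finset.range (N + K), |x i| := by
    rw [Finset.sum_range_add, nsmul_add]
    refine add_le_add (nsmul_le_nsmul_left (hs _) (by omega)) (hK.trans ?_)
    exact nsmul_le_nsmul_left (Finset.sum_nonneg fun i _ => abs_nonneg _) (by omega)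
  -- Disjointness of `a` and `|v|` gives `|v| ⊓ u ≤ p (N + K) - p N`, which is small by the Cauchy
  -- property.
  have h2 := (add_inf_ge_of_disjoint ha (abs_nonneg v) hu hadj).trans (inf_le_inf_right u h1)
  have h0 : 0 ≤ |v| ⊓ u := le_inf (abs_nonneg _) hu
  refine (HasSolidNorm.solid ?_).trans_lt (hN (N + K) (by omega))
  have h3 := le_sub_iff_add_le'.2 h2
  rw [abs_of_nonneg h0, abs_of_nonneg (h0.trans h3)]
  exact h3

/-! ### Truncation to disjoint elements -/

/-- The part of `w` that exceeds `A` in absolute value. -/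
def excess (w A : E) : E := w - ((w ⊓ A) ⊔ -A)

theorem abs_excess_le {w A : E} : |excess w A| ≤ (|w| - A) ⊔ 0 := by
  refine abs_le'.2 ⟨?_, ?_⟩
  · rw [excess, sub_le_iff_le_add, sup_comm, ← sub_le_iff_le_add']
    refine le_trans ?_ le_sup_left
    rw [le_inf_iff]
    refine ⟨?_, ?_⟩
    · exact sub_le_self _ le_sup_left
    · rw [sub_le_comm]
      exact (sub_le_sub_right (le_abs_self w) A).trans le_sup_right
  · rw [excess, neg_sub, sub_le_iff_le_add]
    refine sup_le (inf_le_left.trans (le_add_of_nonneg_left le_sup_right)) ?_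
    rw [← sub_le_iff_le_add]
    refine le_trans ?_ le_sup_left
    rw [neg_sub_left, neg_add', sub_eq_add_neg, sub_eq_add_neg]
    exact add_le_add (neg_le_abs w) le_rfl

theorem abs_sub_excess_le {w A : E} (hA : 0 ≤ A) : |w - excess w A| ≤ |w| ⊓ A := by
  have hw := abs_nonneg w
  rw [excess, sub_sub_cancel]
  refine abs_le'.2 ⟨?_, ?_⟩
  · exact sup_le (inf_le_inf_right _ (le_abs_self w)) ((neg_nonpos.2 hA).trans (le_inf hw hA))
  · rw [neg_le, neg_inf]
    refine sup_le_sup_right (le_inf (neg_le.1 (neg_le_abs w)) ?_) _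
    exact (neg_nonpos.2 hw).trans hA

/-- Truncating `a` by `c • |b|` and `b` by `c⁻¹ • |a|` gives disjoint elements. -/
theorem excess_disjoint {a b A B : E} {c : ℝ} (hc : 0 < c) (hA : c⁻¹ • |b| ≤ A)
    (hB : c • |a| ≤ B) : |excess a A| ⊓ |excess b B| = 0 := by
  -- The two excesses are dominated by `d⁺` and `c • d⁻`, which are disjoint.
  set d := |a| - c⁻¹ • |b|
  have h1 : |excess a A| ≤ d⁺ := abs_excess_le.trans
    (sup_le_sup_right (sub_le_sub_left hA _) _)
  have h2 : |excess b B| ≤ c • d⁻ := by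
    have hd : 0 ≤ c • d⁻ := smul_nonneg hc.le (negPart_nonneg d)
    refine abs_excess_le.trans (sup_le ?_ hd)
    refine (sub_le_sub_left hB _).trans ?_
    have : |b| - c • |a| = c • (-d) := by
      simp only [d, neg_sub, smul_sub, smul_inv_smul₀ hc.ne']
    rw [this]
    exact smul_le_smul_of_nonneg_left (neg_le_negPart d) hc.le
  have h3 : d⁻ ∈ disjointCompl d⁺ := by
    rw [mem_disjointCompl, abs_of_nonneg (posPart_nonneg d), abs_of_nonneg (negPart_nonneg d)]
    exact posPart_inf_negPart_eq_zero d
  have h4 := (disjointCompl d⁺).smul_mem c h3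
  rw [mem_disjointCompl, abs_of_nonneg (posPart_nonneg d),
    abs_of_nonneg (smul_nonneg hc.le (negPart_nonneg d))] at h4
  exact abs_inf_abs_eq_zero_of_le h4 h1 h2

end Disjoint

end BanachLatticeDNS

namespace BanachLatticeDNS

section Operators

variable {E Y : Type*} [NormedAddCommGroup E] [Lattice E] [IsOrderedAddMonoid E] [HasSolidNorm E]
  [NormedSpace ℝ E] [IsOrderedModule ℝ E] [NormedAddCommGroup Y] [NormedSpace ℝ Y]

/-! ### Decay along a disjoint sequence implies strict singularity -/

theorem norm_smul_le_norm_sum_of_disjoint {x : ℕ → E}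
    (hx : ∀ m n, m ≠ n → |x m| ⊓ |x n| = 0) (s : Finset ℕ) (c : ℕ → ℝ) {i : ℕ} (hi : i ∈ s) :
    ‖c i • x i‖ ≤ ‖∑ j ∈ s, c j • x j‖ := by
  rw [← Finset.add_sum_erase s _ hi]
  refine norm_le_norm_add_of_disjoint ?_
  rw [← mem_disjointCompl]
  refine Submodule.sum_mem _ fun j hj => Submodule.smul_mem _ _ ?_
  rw [mem_disjointCompl, inf_comm, ← mem_disjointCompl]
  exact Submodule.smul_mem _ _ (hx j i (Finset.ne_of_mem_erase hj))

theorem linearIndependent_of_disjoint {x : ℕ → E} (h0 : ∀ n, x n ≠ 0)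
    (hx : ∀ m n, m ≠ n → |x m| ⊓ |x n| = 0) : LinearIndependent ℝ x := by
  rw [linearIndependent_iff']
  intro s g hg i hi
  have h1 := norm_smul_le_norm_sum_of_disjoint hx s g hi
  rw [hg, norm_zero, norm_le_zero_iff, smul_eq_zero] at h1
  exact h1.resolve_right (h0 i)

/-- Each term of a disjoint sum has norm at most that of the sum, so the bounds add up as a
geometric series; the factor `2` is its sum. -/
theorem norm_map_le_of_mem_closedSpan_tail (T : E →L[ℝ] Y) {x : ℕ → E} {C : ℝ} (hC : 0 ≤ C)
    (hx : ∀ m n, m ≠ n → |x m| ⊓ |x n| = 0) (hT : ∀ n, ‖T (x n)‖ ≤ C * (1 / 2) ^ n * ‖x n‖)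
    (N : ℕ) {z : E} (hz : z ∈ closedSpan fun n => x (N + n)) :
    ‖T z‖ ≤ C * (1 / 2) ^ N * 2 * ‖z‖ := by
  have hcl : IsClosed {z : E | ‖T z‖ ≤ C * (1 / 2) ^ N * 2 * ‖z‖} :=
    isClosed_le (by fun_prop) (by fun_prop)
  refine closure_minimal ?_ hcl hz
  intro z hz
  obtain ⟨c, rfl⟩ := Finsupp.mem_span_range_iff_exists_finsupp.1 hz
  rw [Finsupp.sum]
  set v := ∑ i ∈ c.support, c i • x (N + i) with hv
  have hb : ∀ i ∈ c.support, ‖T (c i • x (N + i))‖ ≤ C * (1 / 2) ^ N * ‖v‖ * (1 / 2) ^ i := by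
    intro i hi
    have h1 : ‖c i • x (N + i)‖ ≤ ‖v‖ := norm_smul_le_norm_sum_of_disjoint
      (x := fun n => x (N + n)) (fun m n hmn => hx _ _ (by omega)) c.support c hi
    rw [map_smul, norm_smul]
    rw [norm_smul] at h1
    calc ‖c i‖ * ‖T (x (N + i))‖ ≤ ‖c i‖ * (C * (1 / 2) ^ (N + i) * ‖x (N + i)‖) := by
          gcongr
          exact hT _
      _ = C * (1 / 2) ^ N * (1 / 2) ^ i * (‖c i‖ * ‖x (N + i)‖) := by rw [pow_add]; ring
      _ ≤ C * (1 / 2) ^ N * (1 / 2) ^ i * ‖v‖ := by gcongr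
      _ = C * (1 / 2) ^ N * ‖v‖ * (1 / 2) ^ i := by ring
  change ‖T v‖ ≤ _
  have h2 : ‖T v‖ ≤ ∑ i ∈ c.support, C * (1 / 2) ^ N * ‖v‖ * (1 / 2) ^ i := by
    rw [hv, map_sum]
    exact norm_sum_le_of_le _ hb
  rw [← Finset.mul_sum] at h2
  have h3 : ∑ i ∈ c.support, (1 / 2 : ℝ) ^ i ≤ 2 :=
    (summable_geometric_two.sum_le_tsum _ fun i _ => by positivity).trans_eq tsum_geometric_two
  calc ‖T v‖ ≤ C * (1 / 2) ^ N * ‖v‖ * ∑ i ∈ c.support, (1 / 2 : ℝ) ^ i := h2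
    _ ≤ C * (1 / 2) ^ N * ‖v‖ * 2 := by gcongr
    _ = _ := by ring

omit [Lattice E] [IsOrderedAddMonoid E] [HasSolidNorm E] [IsOrderedModule ℝ E] in
theorem closedSpan_le_tail_sup (x : ℕ → E) (N : ℕ) :
    closedSpan x ≤ closedSpan (fun n => x (N + n)) ⊔ Submodule.span ℝ (x '' Set.Iio N) := by
  have hfin : FiniteDimensional ℝ (Submodule.span ℝ (x '' Set.Iio N)) :=
    FiniteDimensional.span_of_finite ℝ ((Set.finite_Iio N).image x)
  refine Submodule.topologicalClosure_minimal _ ?_ (Submodule.isClosed_sup_finiteDimensional _ _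
    (Submodule.isClosed_topologicalClosure _))
  rw [Submodule.span_le]
  rintro _ ⟨n, rfl⟩
  rcases lt_or_ge n N with h | h
  · exact Submodule.mem_sup_right (Submodule.subset_span ⟨n, h, rfl⟩)
  · refine Submodule.mem_sup_left (Submodule.le_topologicalClosure _ (Submodule.subset_span ?_))
    exact ⟨n - N, by simp [Nat.add_sub_cancel' h]⟩

omit [Lattice E] [IsOrderedAddMonoid E] [HasSolidNorm E] [IsOrderedModule ℝ E] in
/-- An infinite dimensional subspace of `[x_n]` meets every tail `[x_n : n ≥ N]`. -/
theorem exists_ne_zero_mem_tail {x : ℕ → E} (M : Submodule ℝ (closedSpan x))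
    (hM : ¬ FiniteDimensional ℝ M) (N : ℕ) :
    ∃ m : M, m ≠ 0 ∧ ((m : closedSpan x) : E) ∈ closedSpan fun n => x (N + n) := by
  by_contra! hcon
  apply hM
  set tail := closedSpan fun n => x (N + n)
  set F := Submodule.span ℝ (x '' Set.Iio N)
  have hfin : FiniteDimensional ℝ F :=
    FiniteDimensional.span_of_finite ℝ ((Set.finite_Iio N).image x)
  -- If `M` met the tail only in `0`, it would embed in the image of `F` modulo the tail, which is
  -- finite dimensional.
  let g : M →ₗ[ℝ] E ⧸ tail := tail.mkQ ∘ₗ (closedSpan x).subtype ∘ₗ M.subtype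
  have hg : ∀ m, g m ∈ F.map tail.mkQ := by
    intro m
    obtain ⟨a, ha, b, hb, hab⟩ :=
      Submodule.mem_sup.1 (closedSpan_le_tail_sup x N (m : closedSpan x).2)
    refine ⟨b, hb, ?_⟩
    have ha0 : tail.mkQ a = 0 := (Submodule.Quotient.mk_eq_zero tail).2 ha
    change tail.mkQ b = tail.mkQ ((m : closedSpan x) : E)
    rw [← hab, map_add, ha0, zero_add]
  refine FiniteDimensional.of_injective (g.codRestrict (F.map tail.mkQ) hg) ?_
  rw [← LinearMap.ker_eq_bot, LinearMap.ker_codRestrict, LinearMap.ker_eq_bot']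
  intro m hm
  by_contra hne
  exact hcon m hne ((Submodule.Quotient.mk_eq_zero tail).1 hm)

/-- If `‖T x_n‖ / ‖x_n‖` decays geometrically along a disjoint sequence, then `T` is strictly
singular on its closed span. -/
theorem isStrictlySingular_of_decay (T : E →L[ℝ] Y) {x : ℕ → E} {C : ℝ} (hC : 0 ≤ C)
    (hx : ∀ m n, m ≠ n → |x m| ⊓ |x n| = 0)
    (hT : ∀ n, ‖T (x n)‖ ≤ C * (1 / 2) ^ n * ‖x n‖) :
    IsStrictlySingular (restr T (closedSpan x)) := by
  rintro ⟨M, -, hM, hemb⟩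
  obtain ⟨K, hK⟩ := ContinuousLinearMap.antilipschitz_of_isEmbedding _ hemb
  have hlim : Filter.Tendsto (fun N : ℕ => (K : ℝ) * (C * (1 / 2) ^ N * 2)) Filter.atTop
      (nhds 0) := by
    have := tendsto_pow_atTop_nhds_zero_of_lt_one (r := (1 / 2 : ℝ)) (by norm_num) (by norm_num)
    simpa using ((this.const_mul C).mul_const 2).const_mul (K : ℝ)
  obtain ⟨N, hN⟩ := (hlim.eventually_lt_const one_pos).exists
  obtain ⟨m, hm0, hm⟩ := exists_ne_zero_mem_tail M hM N
  have h1 : ‖m‖ ≤ K * ‖T ((m : closedSpan x) : E)‖ :=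
    hK.le_mul_norm (map_zero _) m
  have h2 := norm_map_le_of_mem_closedSpan_tail T hC hx hT N hm
  have hpos : 0 < ‖m‖ := norm_pos_iff.2 hm0
  have h3 : ‖m‖ ≤ K * (C * (1 / 2) ^ N * 2 * ‖m‖) := h1.trans (by gcongr; exact h2)
  nlinarith

theorem isDisjointlyNonSingular_of_sigmaD_pos (T : E →L[ℝ] Y) (h : 0 < sigmaD T) :
    IsDisjointlyNonSingular T := by
  rintro ⟨x, hx, hss⟩
  have h1 : 0 < ⨆ y ∈ disjSeqs (closedSpan x), injModulus (restr T (closedSpan y)) :=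
    h.trans_le (iInf₂_le x hx)
  obtain ⟨y, h2⟩ := lt_iSup_iff.1 h1
  obtain ⟨hy, h3⟩ := lt_iSup_iff.1 h2
  obtain ⟨r, hr0, hr⟩ := ENNReal.lt_iff_exists_nnreal_btwn.1 h3
  have hr0' : 0 < r := by exact_mod_cast hr0
  have hbound : ∀ z ∈ closedSpan y, ‖z‖ ≤ (r⁻¹ : NNReal) * ‖T z‖ := by
    intro z hz
    by_cases hz0 : z = 0
    · simp [hz0]
    have hzpos : 0 < ‖z‖ := norm_pos_iff.2 hz0
    have h4 : injModulus (restr T (closedSpan y)) ≤ ‖T (‖z‖⁻¹ • z)‖ₑ := by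
      refine iInf₂_le (⟨‖z‖⁻¹ • z, Submodule.smul_mem _ _ hz⟩ : closedSpan y) ?_
      change ‖‖z‖⁻¹ • z‖ = 1
      rw [norm_smul, norm_inv, norm_norm, inv_mul_cancel₀ hzpos.ne']
    have h5 : (r : ℝ≥0∞) ≤ ‖T (‖z‖⁻¹ • z)‖ₑ := hr.le.trans h4
    rw [enorm_eq_nnnorm, ENNReal.coe_le_coe, ← NNReal.coe_le_coe, coe_nnnorm, map_smul, norm_smul,
      norm_inv, norm_norm, inv_mul_eq_div, le_div_iff₀ hzpos] at h5
    rw [NNReal.coe_inv, inv_mul_eq_div, le_div_iff₀ (by exact_mod_cast hr0')]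
    linarith
  have hyx : closedSpan y ≤ closedSpan x := by
    refine Submodule.topologicalClosure_minimal _ (Submodule.span_le.2 ?_)
      (Submodule.isClosed_topologicalClosure _)
    rintro _ ⟨n, rfl⟩
    exact hy.1 n
  have hmem : ∀ n, y n ∈ closedSpan y := fun n =>
    Submodule.le_topologicalClosure _ (Submodule.subset_span ⟨n, rfl⟩)
  refine hss ⟨(closedSpan y).comap (closedSpan x).subtype, ?_, ?_, ?_⟩
  · exact (Submodule.isClosed_topologicalClosure _).preimage continuous_subtype_val
  · intro hfin
    have hli : LinearIndependent ℝ (fun n => (⟨⟨y n, hy.1 n⟩, hmem n⟩ :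
        (closedSpan y).comap (closedSpan x).subtype)) :=
      LinearIndependent.of_comp ((closedSpan x).subtype ∘ₗ Submodule.subtype _)
        (linearIndependent_of_disjoint hy.2.1 hy.2.2)
    have := hli.finite
    exact not_finite ℕ
  · have hanti : AntilipschitzWith r⁻¹ (restr (restr T (closedSpan x))
        ((closedSpan y).comap (closedSpan x).subtype)) :=
      AddMonoidHomClass.antilipschitz_of_bound _ fun z => hbound _ z.2
    exact (hanti.isUniformEmbedding (ContinuousLinearMap.uniformContinuous _)).isEmbedding

/-! ### From `σ_d(T) = 0` to a disjoint sequence with decay -/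

theorem exists_almost_disjoint_of_sigmaD_eq_zero (hE : IsOrderContinuous E) (T : E →L[ℝ] Y)
    (h : sigmaD T = 0) {u : E} (hu : 0 ≤ u) {ε : ℝ} (hε : 0 < ε) :
    ∃ w : E, ‖w‖ = 1 ∧ ‖T w‖ < ε ∧ ‖|w| ⊓ u‖ < ε := by
  have h1 : sigmaD T < ENNReal.ofReal ε := h ▸ ENNReal.ofReal_pos.2 hε
  obtain ⟨x, h2⟩ := iInf_lt_iff.1 h1
  obtain ⟨hx, h3⟩ := iInf_lt_iff.1 h2
  obtain ⟨N, hN⟩ := hE.exists_tail_norm_inf_lt hx.2.2 hu hε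
  set y : ℕ → E := fun n => x (N + n)
  have hy : y ∈ disjSeqs (closedSpan x) :=
    ⟨fun n => Submodule.le_topologicalClosure _ (Submodule.subset_span ⟨N + n, rfl⟩),
      fun n => hx.2.1 _, fun m n hmn => hx.2.2 _ _ (by omega)⟩
  have h4 : injModulus (restr T (closedSpan y)) < ENNReal.ofReal ε :=
    (le_iSup₂ (f := fun y (_ : y ∈ disjSeqs (closedSpan x)) =>
      injModulus (restr T (closedSpan y))) y hy).trans_lt h3
  obtain ⟨z, h5⟩ := iInf_lt_iff.1 h4
  obtain ⟨hz, h6⟩ := iInf_lt_iff.1 h5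
  have h7 : ‖T (z : E)‖ < ε * ‖(z : E)‖ := by
    have hz' : ‖(z : E)‖ = 1 := hz
    rw [hz', mul_one]
    change ‖T (z : E)‖ₑ < _ at h6
    rwa [← ofReal_norm, ENNReal.ofReal_lt_ofReal_iff hε] at h6
  -- The tail estimate holds on the algebraic span only; the strict inequality, being open, passes
  -- from `z` to a nearby `v` there.
  have hopen : IsOpen {v : E | ‖T v‖ < ε * ‖v‖} := isOpen_lt (by fun_prop) (by fun_prop)
  obtain ⟨v, hv, hvs⟩ := mem_closure_iff.1 z.2 _ hopen h7
  have hv : ‖T v‖ < ε * ‖v‖ := hv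
  have hpos : 0 < ‖v‖ := pos_of_mul_pos_right ((norm_nonneg _).trans_lt hv) hε.le
  refine ⟨‖v‖⁻¹ • v, ?_, ?_, hN _ (Submodule.smul_mem _ _ hvs)⟩
  · rw [norm_smul, norm_inv, norm_norm, inv_mul_cancel₀ hpos.ne']
  · rwa [map_smul, norm_smul, norm_inv, norm_norm, inv_mul_lt_iff₀ hpos, mul_comm]

/-- A disjoint sequence with geometric decay, obtained by truncating a normalized sequence of
almost disjoint vectors. -/
theorem exists_disjoint_decay [CompleteSpace E] (T : E →L[ℝ] Y)
    (h : ∀ u : E, 0 ≤ u → ∀ ε : ℝ, 0 < ε → ∃ w : E, ‖w‖ = 1 ∧ ‖T w‖ < ε ∧ ‖|w| ⊓ u‖ < ε) :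
    ∃ (x : ℕ → E) (C : ℝ), 0 ≤ C ∧ (∀ n, x n ≠ 0) ∧ (∀ m n, m ≠ n → |x m| ⊓ |x n| = 0) ∧
      ∀ n, ‖T (x n)‖ ≤ C * (1 / 2) ^ n * ‖x n‖ := by
  have h' : ∀ (n : ℕ) (u : E), ∃ w : E, 0 ≤ u → ‖w‖ = 1 ∧ ‖T w‖ < (1 / 2) ^ n / 8 ∧
      ‖|w| ⊓ (4 : ℝ) ^ n • u‖ < (1 / 2) ^ n / 8 := by
    intro n u
    by_cases hu : 0 ≤ u
    · obtain ⟨w, hw⟩ := h ((4 : ℝ) ^ n • u) (smul_nonneg (by positivity) hu) ((1 / 2) ^ n / 8)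
        (by positivity)
      exact ⟨w, fun _ => hw⟩
    · exact ⟨0, fun hu' => absurd hu' hu⟩
  choose f hf using h'
  -- `u n` is the sum of `|w k|` over `k < n`.
  let u : ℕ → E := fun n => Nat.rec 0 (fun n u => u + |f n u|) n
  let w : ℕ → E := fun n => f n (u n)
  have husucc : ∀ n, u (n + 1) = u n + |w n| := fun n => rfl
  have humono : Monotone u := monotone_nat_of_le_succ fun n => by
    rw [husucc]
    exact le_add_of_nonneg_right (abs_nonneg _)
  have hu0 : ∀ n, 0 ≤ u n := fun n => humono (Nat.zero_le n)
  have hwu : ∀ {k n}, k < n → |w k| ≤ u n := fun {k n} hkn =>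
    (le_add_of_nonneg_left (hu0 k)).trans ((husucc k).symm.le.trans (humono hkn))
  have hw : ∀ n, ‖w n‖ = 1 ∧ ‖T (w n)‖ < (1 / 2) ^ n / 8 ∧
      ‖|w n| ⊓ (4 : ℝ) ^ n • u n‖ < (1 / 2) ^ n / 8 := fun n => hf n (u n) (hu0 n)
  -- For `n < k`, `w k` is truncated at least at `4ᵏ|w n|`, so `excess_disjoint` with `c = 4ᵏ`
  -- requires truncating `w n` at least at `4⁻ᵏ|w k|`; here `k = n + 1 + j`.
  let t : ℕ → ℕ → E := fun n j => ((4 : ℝ) ^ (n + 1 + j))⁻¹ • |w (n + 1 + j)|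
  have ht0 : ∀ n j, 0 ≤ t n j := fun n j => smul_nonneg (by positivity) (abs_nonneg _)
  have htn : ∀ n j, ‖t n j‖ = (1 / 4) ^ (n + 1) * (1 / 4) ^ j := by
    intro n j
    rw [norm_smul, norm_abs_eq_norm, (hw _).1, mul_one, norm_inv, norm_pow, ← pow_add,
      one_div, inv_pow]
    norm_num
  have hgeo : ∀ n : ℕ, HasSum (fun j : ℕ => (1 / 4 : ℝ) ^ (n + 1) * (1 / 4) ^ j)
      ((1 / 4) ^ (n + 1) * (1 - 1 / 4)⁻¹) := fun n =>
    (hasSum_geometric_of_lt_one (by norm_num) (by norm_num)).mul_left _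
  have htsum : ∀ n, Summable (t n) := fun n =>
    Summable.of_norm_bounded (hgeo n).summable fun j => (htn n j).le
  have hR : ∀ n, ‖∑' j, t n j‖ ≤ (1 / 4) ^ (n + 1) * (1 - 1 / 4)⁻¹ := fun n =>
    tsum_of_norm_bounded (hgeo n) fun j => (htn n j).le
  have hR0 : ∀ n, 0 ≤ ∑' j, t n j := fun n => tsum_nonneg (ht0 n)
  let A : ℕ → E := fun n => (4 : ℝ) ^ n • u n + ∑' j, t n j
  have hu4 : ∀ n, 0 ≤ (4 : ℝ) ^ n • u n := fun n => smul_nonneg (by positivity) (hu0 n)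
  have hA0 : ∀ n, 0 ≤ A n := fun n => add_nonneg (hu4 n) (hR0 n)
  -- The error is at most `2⁻ⁿ/8 + 4⁻ⁿ/3`, and `1/8 + 1/3 < 1/2`.
  have hclose : ∀ n, ‖w n - excess (w n) (A n)‖ ≤ (1 / 2) ^ n / 2 := by
    intro n
    have h1 : |w n - excess (w n) (A n)| ≤ |w n| ⊓ (4 : ℝ) ^ n • u n + ∑' j, t n j :=
      (abs_sub_excess_le (hA0 n)).trans ((inf_add_le_of_nonneg (abs_nonneg _) (hu4 n)
        (hR0 n)).trans (add_le_add le_rfl inf_le_right))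
    have h2 : ‖w n - excess (w n) (A n)‖ ≤ ‖|w n| ⊓ (4 : ℝ) ^ n • u n + ∑' j, t n j‖ :=
      HasSolidNorm.solid (h1.trans (le_abs_self _))
    have h3 := (h2.trans (norm_add_le _ _)).trans (add_le_add (hw n).2.2.le (hR n))
    have h4 : (1 / 4 : ℝ) ^ n ≤ (1 / 2) ^ n := by gcongr; norm_num
    have h5 : (0 : ℝ) < (1 / 2) ^ n := by positivity
    rw [pow_succ] at h3
    norm_num at h3
    linarith
  have hhalf : ∀ n : ℕ, (1 / 2 : ℝ) ^ n ≤ 1 := fun n => pow_le_one₀ (by norm_num) (by norm_num)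
  have hlow : ∀ n, 1 / 2 ≤ ‖excess (w n) (A n)‖ := by
    intro n
    have h1 := norm_sub_norm_le (w n) (w n - excess (w n) (A n))
    rw [sub_sub_cancel, (hw n).1] at h1
    linarith [hclose n, hhalf n]
  have hlt : ∀ n k, n < k → |excess (w n) (A n)| ⊓ |excess (w k) (A k)| = 0 := by
    intro n k hnk
    refine excess_disjoint (c := 4 ^ k) (by positivity) ?_ ?_
    · have h1 := (htsum n).le_tsum (k - (n + 1)) fun j _ => ht0 n j
      simp only [t] at h1
      rw [Nat.add_sub_cancel' hnk] at h1
      exact h1.trans (le_add_of_nonneg_left (hu4 n))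
    · exact (smul_le_smul_of_nonneg_left (hwu hnk) (by positivity)).trans
        (le_add_of_nonneg_right (hR0 k))
  -- The factor `2` in `C` compensates for `‖x_n‖ ≥ 1/2`.
  refine ⟨fun n => excess (w n) (A n), 2 * (1 + ‖T‖), by positivity, fun n h0 => ?_,
    fun m n hmn => ?_, fun n => ?_⟩
  · have := hlow n
    simp only at h0
    rw [h0, norm_zero] at this
    norm_num at this
  · rcases lt_or_gt_of_ne hmn with hlt' | hlt'
    · exact hlt _ _ hlt'
    · rw [inf_comm]
      exact hlt _ _ hlt'
  · have h1 : ‖T (excess (w n) (A n))‖ ≤ ‖T (w n)‖ + ‖T (w n - excess (w n) (A n))‖ := by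
      have := norm_sub_le (T (w n)) (T (w n - excess (w n) (A n)))
      rwa [← map_sub, sub_sub_cancel] at this
    have h2 := T.le_opNorm_of_le (hclose n)
    have h3 : (0 : ℝ) < (1 / 2) ^ n := by positivity
    have h4 : ‖T (excess (w n) (A n))‖ ≤ (1 + ‖T‖) * (1 / 2) ^ n := by
      have := (hw n).2.1
      nlinarith [mul_nonneg (norm_nonneg T) h3.le]
    have h5 : 0 ≤ (1 + ‖T‖) * (1 / 2) ^ n := by positivity
    nlinarith [mul_le_mul_of_nonneg_left (hlow n) h5]

end Operators

end BanachLatticeDNS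

theorem theorem5p3 {E Y : Type*}
    [NormedAddCommGroup E] [Lattice E] [IsOrderedAddMonoid E] [HasSolidNorm E]
    [NormedSpace ℝ E] [IsOrderedModule ℝ E] [CompleteSpace E]
    [NormedAddCommGroup Y] [NormedSpace ℝ Y] [CompleteSpace Y]
    (hE : BanachLatticeDNS.IsOrderContinuous E) (T : E →L[ℝ] Y) :
    BanachLatticeDNS.IsDisjointlyNonSingular T ↔ 0 < BanachLatticeDNS.sigmaD T := by
  refine ⟨fun h => pos_iff_ne_zero.2 fun h0 => h ?_,
    BanachLatticeDNS.isDisjointlyNonSingular_of_sigmaD_pos T⟩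
  obtain ⟨x, C, hC, hx0, hx, hT⟩ := BanachLatticeDNS.exists_disjoint_decay T fun u hu ε hε =>
    BanachLatticeDNS.exists_almost_disjoint_of_sigmaD_eq_zero hE T h0 hu hε
  exact ⟨x, ⟨fun _ => trivial, hx0, hx⟩,
    BanachLatticeDNS.isStrictlySingular_of_decay T hC hx hT⟩
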